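/- There is a universal constant $C>0$ such that the following holds for all integers $r\ge 2$ and $n\ge 0$ and all probability distributions $D_1,\dots,D_n$ on $[0,\infty)$. There is a (possibly randomized) online algorithm, depending only on $r,n,D_1,\dots,D_n$, which observes real numbers $X_1,\dots,X_n$ one at a time, irrevocably accepts or rejects each $X_i$ on arrival (using only $X_1,\dots,X_i$ and its internal randomness), accepts at most $r$ of them, and has the following guarantee. Let $Z_1,\dots,Z_n$ be independent random variables with $Z_i\sim D_i$, let $W_1,\dots,W_n\ge 0$ be random variables on the same probability space, put $X_i=Z_i+W_i$, and suppose that for every $i$ the variable $Z_i$ is independent of $(X_1,\dots,X_{i-1})$. (Otherwise the $W_i$ are arbitrary and unknown to the algorithm; its internal randomness is independent of all $Z_i,W_i$.) If $Q\subseteq\{1,\dots,n\}$ is the random set of accepted indices, then $$\mathbb E\Big[\sum_{i\in Q}X_i\Big]\;\ge\;\frac{1}{1+C\,\frac{(\log r)^{3/2}}{r^{1/4}}}\;\mathbb E\Big[\sum_{k=1}^{r}Z^{(k)}\Big],$$ where $Z^{(k)}$ is the $k$-th largest of $Z_1,\dots,Z_n$ (and $Z^{(k)}=0$ for $k>n$).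 Expectations take values in $[0,\infty]$. -/

import Mathlib

open MeasureTheory ProbabilityTheory

universe u

noncomputable section

/-- The `k`-th largest entry of `z`, counted from `k = 0` and with multiplicity; it is `0` when `z`
has at most `k` entries. -/
def kthLargest {n : ℕ} (z : Fin n → ℝ) (k : ℕ) : ℝ :=
  ((Finset.univ.val.map z).sort (· ≥ ·)).getD k 0

/-- The sum of the `r` largest entries of `z`. -/
def topSum {n : ℕ} (r : ℕ) (z : Fin n → ℝ) : ℝ :=
  ∑ k ∈ Finset.range r, kthLargest z k

/-- A randomized online algorithm that sees `n` real numbers one at a time and irrevocably accepts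
or rejects each of them on arrival, accepting at most `r` in total. The random seed is drawn once,
before the first arrival. -/
structure OnlineAlgorithm (n r : ℕ) where
  /-- The space of random seeds. -/
  Seed : Type
  [measurableSpaceSeed : MeasurableSpace Seed]
  /-- The distribution of the seed. -/
  seedLaw : Measure Seed
  [isProbabilityMeasure_seedLaw : IsProbabilityMeasure seedLaw]
  /-- The set of accepted indices, for a given seed and given values. -/
  accept : Seed → (Fin n → ℝ) → Finset (Fin n)
  measurableSet_accept :
    ∀ i, MeasurableSet {p : Seed × (Fin n → ℝ) | i ∈ accept p.1 p.2}
  /-- The decision on the `i`-th arrival uses only the seed and the values that arrived up to `i`. -/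
  online : ∀ s x y i, (∀ j ≤ i, x j = y j) → (i ∈ accept s x ↔ i ∈ accept s y)
  card_accept_le : ∀ s x, (accept s x).card ≤ r

attribute [instance] OnlineAlgorithm.measurableSpaceSeed
  OnlineAlgorithm.isProbabilityMeasure_seedLaw

/-- The expected total value accepted by the algorithm when the arriving values are `X 0, X 1, …`;
its seed is independent of everything else. -/
def OnlineAlgorithm.expectedReward {n r : ℕ} (A : OnlineAlgorithm n r) {Ω : Type*}
    [MeasurableSpace Ω] (P : Measure Ω) (X : Fin n → Ω → ℝ) : ENNReal :=
  ∫⁻ p, ENNReal.ofReal (∑ i ∈ A.accept p.2 (fun k => X k p.1), X i p.1) ∂(P.prod A.seedLaw)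

/-- `Z` and `W` form an instance of the augmented prophets problem with marginals `D`: the `Z i` are
independent with laws `D i`, the bonuses `W i` are nonnegative, and each `Z i` is independent of the
tuple of all earlier augmented values `Z j + W j`, `j < i`. -/
structure IsAugmentedInstance {n : ℕ} (D : Fin n → Measure ℝ) {Ω : Type*} [MeasurableSpace Ω]
    (P : Measure Ω) (Z W : Fin n → Ω → ℝ) : Prop where
  measurable_Z : ∀ i, Measurable (Z i)
  measurable_W : ∀ i, Measurable (W i)
  law_Z : ∀ i, P.map (Z i) = D i
  iIndepFun_Z : iIndepFun Z P
  nonneg_W : ∀ i, ∀ᵐ ω ∂P, 0 ≤ W i ω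
  indepFun_past : ∀ i,
    IndepFun (Z i) (fun ω (j : {j : Fin n // j < i}) => Z j ω + W j ω) P

/-- On every augmented instance with marginals `D`, the algorithm `A` obtains at least a `1 / α`
fraction of the expected sum of the `r` largest `Z i`. The algorithm may depend on `D` but not on
the bonuses. -/
def OnlineAlgorithm.HasApproximationRatio {n r : ℕ} (A : OnlineAlgorithm n r)
    (D : Fin n → Measure ℝ) (α : ℝ) : Prop :=
  ∀ (Ω : Type u) [MeasurableSpace Ω] (P : Measure Ω) [IsProbabilityMeasure P]
    (Z W : Fin n → Ω → ℝ), IsAugmentedInstance D P Z W →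
      (∫⁻ ω, ENNReal.ofReal (topSum r (fun i => Z i ω)) ∂P) / ENNReal.ofReal α ≤
        A.expectedReward P (fun i ω => Z i ω + W i ω)

end

/-! Fix a potential Φ(i, m), a lower estimate of what arrivals i, i+1, … are worth with m slots
left, and accept X_i exactly when X_i + Φ(i+1, m-1) ≥ Φ(i+1, m). One step then yields max(X_i +
Φ(i+1, m-1), Φ(i+1, m)), which is monotone in X_i, so a nonnegative bonus never hurts. The slot
count m depends only on earlier augmented values and is therefore independent of Z_i. If Φ is below
the expected one-step maximum under D_i, telescoping gives reward at least Φ(0, r) for all bonuses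
(`potential_le_expectedReward`).

It remains to find Φ with Φ(0, r) close to the prophet's value. A threshold rule b accepting about r
values on average satisfies E[top r] ≤ Σ E[b(Z_i) Z_i] (`lintegral_topSum_le`). Thin b by 1 - t/2
with t = r^(-1/4), and let Φ be the expected value of the remaining thinned acceptances times one
minus a Chernoff bound for their number reaching m. The Chernoff bound obeys the recursion of a
binomial tail, so Φ is admissible (`isSubPotential_thresholdPotential`). Thinning and overflow
together cost a factor 1 + 33 r^(-1/4), and the logarithm in the theorem is pure slack. -/

/-! ### Greedy algorithm of a potential -/

open Classical in
/-- The number of slots left before the `i`-th arrival for the greedy algorithm of a potential `Φ`,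
which accepts a value when this does not decrease value plus potential. -/
noncomputable def slotsLeft (Φ : ℕ → ℕ → ENNReal) (r : ℕ) (x : ℕ → ℝ) : ℕ → ℕ
  | 0 => r
  | i + 1 =>
    if 0 < slotsLeft Φ r x i ∧ Φ (i + 1) (slotsLeft Φ r x i) ≤
        ENNReal.ofReal (x i) + Φ (i + 1) (slotsLeft Φ r x i - 1)
    then slotsLeft Φ r x i - 1 else slotsLeft Φ r x i

/-- The acceptance rule of the greedy algorithm of a potential `Φ`. -/
def greedyAccepts (Φ : ℕ → ℕ → ENNReal) (r : ℕ) (x : ℕ → ℝ) (i : ℕ) : Prop :=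
  0 < slotsLeft Φ r x i ∧ Φ (i + 1) (slotsLeft Φ r x i) ≤
    ENNReal.ofReal (x i) + Φ (i + 1) (slotsLeft Φ r x i - 1)

open Classical in
theorem slotsLeft_succ (Φ : ℕ → ℕ → ENNReal) (r : ℕ) (x : ℕ → ℝ) (i : ℕ) :
    slotsLeft Φ r x (i + 1) =
      if greedyAccepts Φ r x i then slotsLeft Φ r x i - 1 else slotsLeft Φ r x i := by
  rw [slotsLeft]
  unfold greedyAccepts
  congr

theorem slotsLeft_congr (Φ : ℕ → ℕ → ENNReal) (r : ℕ) {x y : ℕ → ℝ} {i : ℕ}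
    (h : ∀ j < i, x j = y j) : slotsLeft Φ r x i = slotsLeft Φ r y i := by
  induction i with
  | zero => rfl
  | succ i ih =>
    rw [slotsLeft_succ, slotsLeft_succ, greedyAccepts, greedyAccepts,
      ih fun j hj => h j (by omega), h i (by omega)]

theorem greedyAccepts_congr (Φ : ℕ → ℕ → ENNReal) (r : ℕ) {x y : ℕ → ℝ} {i : ℕ}
    (h : ∀ j ≤ i, x j = y j) : greedyAccepts Φ r x i ↔ greedyAccepts Φ r y i := by
  rw [greedyAccepts, greedyAccepts, slotsLeft_congr Φ r fun j hj => h j hj.le, h i le_rfl]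

theorem measurableSet_greedyAccepts_of_measurable (Φ : ℕ → ℕ → ENNReal) (r i : ℕ)
    (h : Measurable fun x : ℕ → ℝ => slotsLeft Φ r x i) :
    MeasurableSet {x | greedyAccepts Φ r x i} := by
  have h1 : Measurable fun x : ℕ → ℝ => Φ (i + 1) (slotsLeft Φ r x i) :=
    (measurable_of_countable (Φ (i + 1))).comp h
  have h2 : Measurable fun x : ℕ → ℝ => Φ (i + 1) (slotsLeft Φ r x i - 1) :=
    (measurable_of_countable fun m => Φ (i + 1) (m - 1)).comp h
  exact (measurableSet_lt measurable_const h).inter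
    (measurableSet_le h1 ((measurable_pi_apply i).ennreal_ofReal.add h2))

theorem measurable_slotsLeft (Φ : ℕ → ℕ → ENNReal) (r i : ℕ) :
    Measurable fun x : ℕ → ℝ => slotsLeft Φ r x i := by
  classical
  induction i with
  | zero => exact measurable_const
  | succ i ih =>
    simp only [slotsLeft_succ]
    exact Measurable.ite (measurableSet_greedyAccepts_of_measurable Φ r i ih)
      ((measurable_of_countable fun m : ℕ => m - 1).comp ih) ih

theorem measurableSet_greedyAccepts (Φ : ℕ → ℕ → ENNReal) (r i : ℕ) :
    MeasurableSet {x | greedyAccepts Φ r x i} :=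
  measurableSet_greedyAccepts_of_measurable Φ r i (measurable_slotsLeft Φ r i)

open Classical in
theorem card_greedyAccepts_add_slotsLeft (Φ : ℕ → ℕ → ENNReal) (r : ℕ) (x : ℕ → ℝ) (k : ℕ) :
    ((Finset.range k).filter (greedyAccepts Φ r x)).card + slotsLeft Φ r x k = r := by
  induction k with
  | zero => simp [slotsLeft]
  | succ k ih =>
    rw [Finset.range_add_one, Finset.filter_insert, slotsLeft_succ]
    split_ifs with h
    · rw [Finset.card_insert_of_notMem (by simp)]
      have := h.1
      omega
    · exact ih

/-- Extension of a finite sequence by `0`. -/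
noncomputable def extendZero {n : ℕ} (x : Fin n → ℝ) (j : ℕ) : ℝ := if h : j < n then x ⟨j, h⟩ else 0

theorem extendZero_val {n : ℕ} (x : Fin n → ℝ) (i : Fin n) : extendZero x i = x i := by
  simp [extendZero]

theorem measurable_extendZero {n : ℕ} : Measurable (extendZero : (Fin n → ℝ) → ℕ → ℝ) := by
  refine measurable_pi_lambda _ fun j => ?_
  unfold extendZero
  by_cases h : j < n
  · simpa [h] using measurable_pi_apply _
  · simp [h]

open Classical in
/-- The greedy algorithm of a potential. It is deterministic. -/
noncomputable def greedyAlgorithm (n r : ℕ) (Φ : ℕ → ℕ → ENNReal) : OnlineAlgorithm n r where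
  Seed := Unit
  seedLaw := Measure.dirac ()
  accept _ x := Finset.univ.filter fun i => greedyAccepts Φ r (extendZero x) i
  measurableSet_accept i := by
    simp only [Finset.mem_filter, Finset.mem_univ, true_and]
    exact (measurable_extendZero.comp measurable_snd) (measurableSet_greedyAccepts Φ r i)
  online s x y i h := by
    simp only [Finset.mem_filter, Finset.mem_univ, true_and]
    refine greedyAccepts_congr Φ r fun j hj => ?_
    have hjn : j < n := hj.trans_lt i.2
    simpa [extendZero, hjn] using h ⟨j, hjn⟩ hj
  card_accept_le s x := by
    have h := card_greedyAccepts_add_slotsLeft Φ r (extendZero x) n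
    refine le_trans ?_ (le_trans (Nat.le_add_right _ _) h.le)
    refine Finset.card_le_card_of_injOn (fun i : Fin n => (i : ℕ)) ?_
      (fun i _ j _ hij => Fin.ext hij)
    intro i hi
    simpa using hi

/-! ### Guarantee of the greedy algorithm under arbitrary bonuses -/

/-- A potential that never exceeds the expected value of one greedy step. -/
structure IsSubPotential {n : ℕ} (D : Fin n → Measure ℝ) (Φ : ℕ → ℕ → ENNReal) : Prop where
  last : ∀ m, Φ n m = 0
  no_slots : ∀ i, Φ i 0 = 0
  step : ∀ (i : Fin n) m, Φ i (m + 1) ≤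
    ∫⁻ z, max (ENNReal.ofReal z + Φ (i + 1) m) (Φ (i + 1) (m + 1)) ∂(D i)

/-- The slot count is a measurable function of the augmented values before `i`, so `indepFun_past`
applies. -/
theorem indepFun_slotsLeft {n : ℕ} {D : Fin n → Measure ℝ} {Ω : Type*} [MeasurableSpace Ω]
    {P : Measure Ω} {Z W : Fin n → Ω → ℝ} (h : IsAugmentedInstance D P Z W)
    (Φ : ℕ → ℕ → ENNReal) (r : ℕ) (i : Fin n) :
    IndepFun (Z i) (fun ω => slotsLeft Φ r (extendZero fun k => Z k ω + W k ω) i) P := by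
  let ext : ({j : Fin n // j < i} → ℝ) → ℕ → ℝ := fun y j =>
    if hj : j < i then y ⟨⟨j, hj.trans i.2⟩, hj⟩ else 0
  have hext : Measurable ext := by
    refine measurable_pi_lambda _ fun j => ?_
    by_cases hj : j < i
    · simpa [ext, hj] using measurable_pi_apply _
    · simp [ext, hj]
  have hcomp := (h.indepFun_past i).comp measurable_id
    ((measurable_slotsLeft Φ r i).comp hext)
  have heq : (fun ω => slotsLeft Φ r (extendZero fun k => Z k ω + W k ω) i) =
      ((fun x => slotsLeft Φ r x i) ∘ ext) ∘
        fun ω (j : {j : Fin n // j < i}) => Z j ω + W j ω := by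
    funext ω
    refine slotsLeft_congr Φ r fun j hj => ?_
    simp [ext, extendZero, hj, hj.trans i.2]
  rw [heq]
  exact hcomp

theorem measurable_augmented {n : ℕ} {D : Fin n → Measure ℝ} {Ω : Type*} [MeasurableSpace Ω]
    {P : Measure Ω} {Z W : Fin n → Ω → ℝ} (h : IsAugmentedInstance D P Z W) :
    Measurable fun ω => extendZero fun k => Z k ω + W k ω :=
  measurable_extendZero.comp
    (measurable_pi_lambda _ fun k => (h.measurable_Z k).add (h.measurable_W k))

-- Independence lets a fresh sample from `D i` in the step inequality be replaced by the actual `Z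
-- i`; the greedy choice made on `Z i + W i` then does at least as well as the best choice for `Z
-- i`.
open Classical in
theorem lintegral_potential_le_step {n : ℕ} {D : Fin n → Measure ℝ} {Φ : ℕ → ℕ → ENNReal}
    (hΦ : IsSubPotential D Φ) {Ω : Type*} [MeasurableSpace Ω]
    {P : Measure Ω} [IsProbabilityMeasure P] {Z W : Fin n → Ω → ℝ}
    (h : IsAugmentedInstance D P Z W) (r : ℕ) (i : Fin n) :
    ∫⁻ ω, Φ i (slotsLeft Φ r (extendZero fun k => Z k ω + W k ω) i) ∂P ≤
      ∫⁻ ω, ((if greedyAccepts Φ r (extendZero fun k => Z k ω + W k ω) i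
        then ENNReal.ofReal (Z i ω + W i ω) else 0) +
        Φ (i + 1) (slotsLeft Φ r (extendZero fun k => Z k ω + W k ω) (i + 1))) ∂P := by
  let M : Ω → ℕ := fun ω => slotsLeft Φ r (extendZero fun k => Z k ω + W k ω) i
  have hM : Measurable M := (measurable_slotsLeft Φ r i).comp (measurable_augmented h)
  -- With no slots left, `p.1 - 1` would truncate to `0` and credit a value that cannot be accepted,
  -- hence the separate case.
  let f : ℕ × ℝ → ENNReal := fun p => if p.1 = 0 then 0 else
    max (ENNReal.ofReal p.2 + Φ (i + 1) (p.1 - 1)) (Φ (i + 1) p.1)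
  have hf : Measurable f := by
    refine measurable_from_prod_countable_right fun m => ?_
    by_cases hm : m = 0
    · simp [f, hm]
    · simp only [f, hm, if_false]
      fun_prop
  have hZ := h.measurable_Z i
  have hind : P.map (fun ω => (M ω, Z i ω)) = (P.map M).prod (P.map (Z i)) :=
    (indepFun_iff_map_prod_eq_prod_map_map hM.aemeasurable hZ.aemeasurable).1
      (indepFun_slotsLeft h Φ r i).symm
  have : IsProbabilityMeasure (P.map (Z i)) := Measure.isProbabilityMeasure_map hZ.aemeasurable
  calc ∫⁻ ω, Φ i (M ω) ∂P
      ≤ ∫⁻ ω, ∫⁻ z, f (M ω, z) ∂(D i) ∂P := by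
        refine lintegral_mono fun ω => ?_
        rcases hm : M ω with _ | m
        · simp [hΦ.no_slots]
        · simpa [f] using hΦ.step i m
    _ = ∫⁻ m, ∫⁻ z, f (m, z) ∂(P.map (Z i)) ∂(P.map M) := by
        rw [h.law_Z i, lintegral_map (measurable_of_countable _) hM]
    _ = ∫⁻ p, f p ∂((P.map M).prod (P.map (Z i))) := by
        rw [lintegral_prod _ hf.aemeasurable]
    _ = ∫⁻ ω, f (M ω, Z i ω) ∂P := by
        rw [← hind, lintegral_map hf (hM.prodMk hZ)]
    _ ≤ _ := by
        refine lintegral_mono_ae ?_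
        filter_upwards [h.nonneg_W i] with ω hW
        have hle : ENNReal.ofReal (Z i ω) ≤ ENNReal.ofReal (Z i ω + W i ω) :=
          ENNReal.ofReal_le_ofReal (by linarith)
        rw [slotsLeft_succ]
        have hX := extendZero_val (fun k => Z k ω + W k ω) i
        by_cases hm : M ω = 0
        · simp [f, hm]
        · simp only [f, hm, if_false]
          by_cases hacc : greedyAccepts Φ r (extendZero fun k => Z k ω + W k ω) i
          · rw [if_pos hacc, if_pos hacc]
            have h2 := hacc.2
            rw [hX] at h2
            exact max_le (add_le_add_left hle _) h2
          · rw [if_neg hacc, if_neg hacc, zero_add]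
            refine max_le ?_ le_rfl
            have hpos : 0 < slotsLeft Φ r (extendZero fun k => Z k ω + W k ω) i :=
              Nat.pos_of_ne_zero hm
            have h2 : ¬ _ := fun h' => hacc ⟨hpos, h'⟩
            rw [hX, not_le] at h2
            exact (add_le_add_left hle _).trans h2.le

open Classical in
theorem lintegral_potential_le_sum {n : ℕ} {D : Fin n → Measure ℝ} {Φ : ℕ → ℕ → ENNReal}
    (hΦ : IsSubPotential D Φ) {Ω : Type*} [MeasurableSpace Ω]
    {P : Measure Ω} [IsProbabilityMeasure P] {Z W : Fin n → Ω → ℝ}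
    (h : IsAugmentedInstance D P Z W) (r k : ℕ) (hk : k ≤ n) :
    Φ 0 r ≤ ∑ j ∈ Finset.range k,
      ∫⁻ ω, (if greedyAccepts Φ r (extendZero fun k => Z k ω + W k ω) j
        then ENNReal.ofReal (extendZero (fun k => Z k ω + W k ω) j) else 0) ∂P +
      ∫⁻ ω, Φ k (slotsLeft Φ r (extendZero fun k => Z k ω + W k ω) k) ∂P := by
  induction k with
  | zero => simp [slotsLeft]
  | succ k ih =>
    refine (ih (by omega)).trans ?_
    rw [Finset.sum_range_succ, add_assoc]
    refine add_le_add_right ?_ _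
    refine (lintegral_potential_le_step hΦ h r ⟨k, by omega⟩).trans_eq ?_
    rw [lintegral_add_right]
    · congr 2
      funext ω
      rw [← extendZero_val (fun k => Z k ω + W k ω) ⟨k, by omega⟩]
    · exact (measurable_of_countable (Φ (k + 1))).comp
        ((measurable_slotsLeft Φ r (k + 1)).comp (measurable_augmented h))

/-- The greedy algorithm of a potential obtains at least the initial potential, whatever the
bonuses are. -/
theorem potential_le_expectedReward {n : ℕ} {D : Fin n → Measure ℝ} {Φ : ℕ → ℕ → ENNReal}
    (hΦ : IsSubPotential D Φ) (hD : ∀ i, ∀ᵐ z ∂(D i), 0 ≤ z) {Ω : Type*} [MeasurableSpace Ω]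
    {P : Measure Ω} [IsProbabilityMeasure P] {Z W : Fin n → Ω → ℝ}
    (h : IsAugmentedInstance D P Z W) (r : ℕ) :
    Φ 0 r ≤ (greedyAlgorithm n r Φ).expectedReward P (fun i ω => Z i ω + W i ω) := by
  classical
  have hZ : ∀ i, ∀ᵐ ω ∂P, 0 ≤ Z i ω := fun i =>
    ae_of_ae_map (h.measurable_Z i).aemeasurable (by rw [h.law_Z i]; exact hD i)
  have hsum := lintegral_potential_le_sum hΦ h r n le_rfl
  simp only [hΦ.last, lintegral_zero, add_zero] at hsum
  have hmeas : ∀ j, Measurable fun ω =>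
      (if greedyAccepts Φ r (extendZero fun k => Z k ω + W k ω) j
        then ENNReal.ofReal (extendZero (fun k => Z k ω + W k ω) j) else 0) := fun j =>
    Measurable.ite (measurable_augmented h (measurableSet_greedyAccepts Φ r j))
      ((measurable_pi_apply j).comp (measurable_augmented h)).ennreal_ofReal measurable_const
  rw [← lintegral_finsetSum _ fun j _ => hmeas j] at hsum
  have hfst : P = (P.prod (greedyAlgorithm n r Φ).seedLaw).map Prod.fst := by simp
  refine hsum.trans ?_
  rw [OnlineAlgorithm.expectedReward]
  conv_lhs => rw [hfst]
  rw [lintegral_map (Finset.measurable_sum _ fun j _ => hmeas j) measurable_fst]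
  refine lintegral_mono_ae ?_
  have hpos : ∀ᵐ ω ∂((P.prod (greedyAlgorithm n r Φ).seedLaw).map Prod.fst),
      ∀ i, 0 ≤ Z i ω + W i ω := by
    rw [← hfst]
    refine ae_all_iff.2 fun i => ?_
    filter_upwards [hZ i, h.nonneg_W i] with ω h1 h2 using add_nonneg h1 h2
  filter_upwards [ae_of_ae_map measurable_fst.aemeasurable hpos] with p hp
  rw [ENNReal.ofReal_sum_of_nonneg fun i _ => hp i, Finset.sum_range]
  simp only [greedyAlgorithm, Finset.sum_filter, extendZero_val]
  exact le_rfl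

/-! ### Threshold bound on the prophet -/

theorem sum_range_getD_le {g : ℝ → ℝ} (hg : ∀ x, 0 ≤ g x) (hg0 : g 0 = 0) (l : List ℝ) (r : ℕ) :
    ∑ k ∈ Finset.range r, g (l.getD k 0) ≤ (l.map g).sum := by
  induction l generalizing r with
  | nil => simp [hg0]
  | cons a l ih =>
    cases r with
    | zero => simpa using add_nonneg (hg a) (List.sum_nonneg (by simp; intro x _; exact hg x))
    | succ r =>
      rw [Finset.sum_range_succ']
      simpa [add_comm] using ih r

theorem topSum_le {n : ℕ} (r : ℕ) (z : Fin n → ℝ) {T : ℝ} (hT : 0 ≤ T) :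
    topSum r z ≤ r * T + ∑ i, max (z i - T) 0 := by
  have h1 : topSum r z ≤ ∑ k ∈ Finset.range r, (T + max (kthLargest z k - T) 0) :=
    Finset.sum_le_sum fun k _ => by linarith [le_max_left (kthLargest z k - T) 0]
  have h2 := sum_range_getD_le (g := fun x => max (x - T) 0) (fun x => le_max_right _ _)
    (by simpa using hT) ((Finset.univ.val.map z).sort (· ≥ ·)) r
  have h3 : (((Finset.univ.val.map z).sort (· ≥ ·)).map fun x => max (x - T) 0).sum =
      ∑ i, max (z i - T) 0 := by
    rw [← Multiset.sum_coe, ← Multiset.map_coe, Multiset.sort_eq, Multiset.map_map]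
    rfl
  rw [Finset.sum_add_distrib] at h1
  simp only [Finset.sum_const, Finset.card_range, nsmul_eq_mul] at h1
  rw [h3] at h2
  exact h1.trans (by simpa [kthLargest] using h2)

/-- `T` is the level exceeded by `r` values on average, where `μ` is the sum of the laws; `b`
randomizes on a possible atom at `T` to hit mass `r` exactly. If fewer values are positive, `T = 0`
works and the last inequality is trivial. -/
theorem exists_threshold (μ : Measure ℝ) [IsFiniteMeasure μ] {r : ℕ} (hr0 : 0 < r) :
    ∃ (T : ℝ) (b : ℝ → ENNReal), 0 ≤ T ∧ Measurable b ∧ (∀ z, b z ≤ 1) ∧ (∀ z < T, b z = 0) ∧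
      (∀ z, T < z → b z = 1) ∧ ∫⁻ z, b z ∂μ ≤ r ∧
      r * ENNReal.ofReal T ≤ (∫⁻ z, b z ∂μ) * ENNReal.ofReal T := by
  by_cases h0 : μ (Set.Ioi 0) ≤ r
  · refine ⟨0, (Set.Ioi 0).indicator 1, le_rfl, measurable_one.indicator measurableSet_Ioi,
      fun z => Set.indicator_le_self _ _ _, fun z hz => ?_, fun z hz => ?_, ?_, by simp⟩
    · simp [hz.le]
    · simp [hz]
    · simpa [lintegral_indicator_one measurableSet_Ioi] using h0
  have hr : 0 < (r : ENNReal) := by exact_mod_cast hr0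
  let A : Set ℝ := {t | 0 ≤ t ∧ μ (Set.Ioi t) ≤ r}
  have hA : A.Nonempty := by
    have hlim : Filter.Tendsto (fun k : ℕ => μ (Set.Ioi (k : ℝ))) Filter.atTop
        (nhds (μ (⋂ k : ℕ, Set.Ioi (k : ℝ)))) :=
      tendsto_measure_iInter_atTop (fun k => measurableSet_Ioi.nullMeasurableSet)
        (fun a b hab => Set.Ioi_subset_Ioi (by exact_mod_cast hab)) ⟨0, measure_ne_top _ _⟩
    have hemp : (⋂ k : ℕ, Set.Ioi (k : ℝ)) = ∅ := by
      refine Set.eq_empty_of_forall_notMem fun x hx => ?_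
      obtain ⟨k, hk⟩ := exists_nat_gt x
      exact absurd (Set.mem_iInter.1 hx k) (not_lt.2 hk.le)
    rw [hemp, measure_empty] at hlim
    obtain ⟨k, hk⟩ := (hlim.eventually (gt_mem_nhds hr)).exists
    exact ⟨k, Nat.cast_nonneg k, hk.le⟩
  have hbdd : BddBelow A := ⟨0, fun t ht => ht.1⟩
  have hT0 : 0 ≤ sInf A := le_csInf hA fun t ht => ht.1
  have hpos : ∀ k : ℕ, 0 < (1 : ℝ) / (k + 1) := fun k => by positivity
  have hupper : μ (Set.Ioi (sInf A)) ≤ r := by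
    have hU : Set.Ioi (sInf A) = ⋃ k : ℕ, Set.Ioi (sInf A + 1 / ((k : ℝ) + 1)) := by
      ext x
      simp only [Set.mem_Ioi, Set.mem_iUnion]
      refine ⟨fun hx => ?_, fun ⟨k, hk⟩ => by linarith [hpos k]⟩
      obtain ⟨k, hk⟩ := exists_nat_one_div_lt (sub_pos.2 hx)
      exact ⟨k, by linarith⟩
    rw [hU, Monotone.measure_iUnion]
    · refine iSup_le fun k => ?_
      obtain ⟨t, ht, htk⟩ := exists_lt_of_csInf_lt hA (lt_add_of_pos_right (sInf A) (hpos k))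
      exact (measure_mono (Set.Ioi_subset_Ioi htk.le)).trans ht.2
    · intro a b hab
      refine Set.Ioi_subset_Ioi ?_
      have := Nat.one_div_le_one_div (α := ℝ) hab
      linarith
  have hTpos : 0 < sInf A := by
    refine lt_of_le_of_ne hT0 fun h => h0 ?_
    rw [h]
    exact hupper
  -- Approaching `T` from below needs `T > 0`, since only nonnegative levels compete in the infimum.
  have hlower : (r : ENNReal) ≤ μ (Set.Ici (sInf A)) := by
    have hI : Set.Ici (sInf A) = ⋂ k : ℕ, Set.Ioi (sInf A - 1 / ((k : ℝ) + 1)) := by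
      ext x
      simp only [Set.mem_Ici, Set.mem_iInter, Set.mem_Ioi]
      refine ⟨fun hx k => by linarith [hpos k], fun hx => ?_⟩
      by_contra! hlt
      obtain ⟨k, hk⟩ := exists_nat_one_div_lt (sub_pos.2 hlt)
      linarith [hx k]
    rw [hI]
    refine ge_of_tendsto (tendsto_measure_iInter_atTop
      (fun k => measurableSet_Ioi.nullMeasurableSet) (fun a b hab => ?_)
      ⟨0, measure_ne_top _ _⟩) (Filter.Eventually.of_forall fun k => ?_)
    · refine Set.Ioi_subset_Ioi ?_
      have := Nat.one_div_le_one_div (α := ℝ) hab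
      linarith
    · have hmax : max (sInf A - 1 / ((k : ℝ) + 1)) 0 < sInf A :=
        max_lt (by linarith [hpos k]) hTpos
      have hnot := notMem_of_lt_csInf hmax hbdd
      have hlt : (r : ENNReal) < μ (Set.Ioi (max (sInf A - 1 / ((k : ℝ) + 1)) 0)) := by
        by_contra! hle
        exact hnot ⟨le_max_right _ _, hle⟩
      exact hlt.le.trans (measure_mono (Set.Ioi_subset_Ioi (le_max_left _ _)))
  have hsplit : μ (Set.Ici (sInf A)) = μ {sInf A} + μ (Set.Ioi (sInf A)) := by
    rw [← Set.Ioi_insert, Set.insert_eq, measure_union (by simp) measurableSet_Ioi]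
  let θ : ENNReal := (r - μ (Set.Ioi (sInf A))) / μ {sInf A}
  have hdiff : (r : ENNReal) - μ (Set.Ioi (sInf A)) ≤ μ {sInf A} :=
    tsub_le_iff_right.2 (hsplit ▸ hlower)
  have hθ1 : θ ≤ 1 := ENNReal.div_le_of_le_mul (by simpa using hdiff)
  have hθ : θ * μ {sInf A} + μ (Set.Ioi (sInf A)) = r := by
    have : θ * μ {sInf A} = r - μ (Set.Ioi (sInf A)) := by
      by_cases hz : μ {sInf A} = 0
      · rw [hz] at hdiff ⊢
        rw [mul_zero, le_antisymm hdiff zero_le]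
      · exact ENNReal.div_mul_cancel hz (measure_ne_top _ _)
    rw [this, tsub_add_cancel_of_le hupper]
  let b : ℝ → ENNReal := fun z =>
    ({sInf A} : Set ℝ).indicator (fun _ => θ) z + (Set.Ioi (sInf A)).indicator (fun _ => 1) z
  have hint : ∫⁻ z, b z ∂μ = r := by
    rw [lintegral_add_right _ (measurable_const.indicator measurableSet_Ioi),
      lintegral_indicator_const (measurableSet_singleton _),
      lintegral_indicator_const measurableSet_Ioi, one_mul, hθ]
  refine ⟨sInf A, b, hT0, (measurable_const.indicator (measurableSet_singleton _)).add
    (measurable_const.indicator measurableSet_Ioi), fun z => ?_, fun z hz => ?_, fun z hz => ?_,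
    hint.le, by rw [hint]⟩
  · rcases lt_trichotomy z (sInf A) with hz | hz | hz
    · simp [b, hz.ne, hz.le]
    · simp [b, hz, hθ1]
    · simp [b, hz, hz.ne']
  · simp [b, hz.ne, hz.le]
  · simp [b, hz, hz.ne']

/-- Each of the top `r` values is at most `T` plus its excess over `T`. As `b` has mass at least `r`
(unless `T = 0`), the pointwise identity b(z)T + (z - T)⁺ = b(z)z⁺ absorbs the term `r * T`. -/
theorem lintegral_topSum_le {n : ℕ} {D : Fin n → Measure ℝ} {Ω : Type*} [MeasurableSpace Ω]
    {P : Measure Ω} [IsProbabilityMeasure P] {Z : Fin n → Ω → ℝ} (hZ : ∀ i, Measurable (Z i))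
    (hlaw : ∀ i, P.map (Z i) = D i) {r : ℕ} {T : ℝ} (hT : 0 ≤ T) {b : ℝ → ENNReal}
    (hb : Measurable b) (hb0 : ∀ z < T, b z = 0) (hb1 : ∀ z, T < z → b z = 1)
    (hr : r * ENNReal.ofReal T ≤ (∑ i, ∫⁻ z, b z ∂(D i)) * ENNReal.ofReal T) :
    ∫⁻ ω, ENNReal.ofReal (topSum r fun i => Z i ω) ∂P ≤
      ∑ i, ∫⁻ z, b z * ENNReal.ofReal z ∂(D i) := by
  have hpt : ∀ z, b z * ENNReal.ofReal T + ENNReal.ofReal (z - T) = b z * ENNReal.ofReal z := by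
    intro z
    rcases lt_trichotomy z T with hz | hz | hz
    · simp [hb0 z hz, hz.le]
    · simp [hz]
    · rw [hb1 z hz, one_mul, one_mul, ← ENNReal.ofReal_add hT (by linarith)]
      congr 1
      ring
  calc ∫⁻ ω, ENNReal.ofReal (topSum r fun i => Z i ω) ∂P
      ≤ ∫⁻ ω, (r * ENNReal.ofReal T + ∑ i, ENNReal.ofReal (Z i ω - T)) ∂P := by
        refine lintegral_mono fun ω => ?_
        refine (ENNReal.ofReal_le_ofReal (topSum_le r (fun i => Z i ω) hT)).trans ?_
        refine ENNReal.ofReal_add_le.trans ?_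
        rw [ENNReal.ofReal_mul (by positivity), ENNReal.ofReal_natCast,
          ENNReal.ofReal_sum_of_nonneg fun i _ => le_max_right _ _]
        simp
    _ = r * ENNReal.ofReal T + ∑ i, ∫⁻ ω, ENNReal.ofReal (Z i ω - T) ∂P := by
        rw [lintegral_add_left measurable_const, lintegral_finsetSum]
        · simp
        · exact fun i _ => ((hZ i).sub_const T).ennreal_ofReal
    _ = r * ENNReal.ofReal T + ∑ i, ∫⁻ z, ENNReal.ofReal (z - T) ∂(D i) := by
        congr 1
        refine Finset.sum_congr rfl fun i _ => ?_
        rw [← hlaw i, lintegral_map (by fun_prop) (hZ i)]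
    _ ≤ (∑ i, ∫⁻ z, b z ∂(D i)) * ENNReal.ofReal T +
          ∑ i, ∫⁻ z, ENNReal.ofReal (z - T) ∂(D i) := add_le_add_left hr _
    _ = ∑ i, ∫⁻ z, b z * ENNReal.ofReal z ∂(D i) := by
        rw [Finset.sum_mul, ← Finset.sum_add_distrib]
        refine Finset.sum_congr rfl fun i _ => ?_
        rw [← lintegral_mul_const _ hb, ← lintegral_add_left (hb.mul_const _)]
        simp_rw [hpt]

/-! ### Chernoff tails and the threshold potential -/

/-- The exponential bound on the probability that independent Bernoulli trials with success
probabilities `p j`, `i ≤ j`, have at least `m` successes. -/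
noncomputable def chernoffTail {n : ℕ} (p : Fin n → ℝ) (lam : ℝ) (i m : ℕ) : ℝ :=
  Real.exp (-(lam * m)) * ∏ j : Fin n with i ≤ j.val, (1 + p j * (Real.exp lam - 1))

theorem filter_le_val_eq_insert {n : ℕ} (i : Fin n) :
    (Finset.univ.filter fun j : Fin n => i.val ≤ j.val) =
      insert i (Finset.univ.filter fun j : Fin n => i.val + 1 ≤ j.val) := by
  ext j
  simp only [Finset.mem_filter, Finset.mem_univ, true_and, Finset.mem_insert, Fin.ext_iff]
  omega

/-- Conditioning on trial `i`: a success uses up one of the `m + 1` successes, which costs a factor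
`exp lam`. -/
theorem chernoffTail_succ {n : ℕ} (p : Fin n → ℝ) (lam : ℝ) (i : Fin n) (m : ℕ) :
    chernoffTail p lam i (m + 1) =
      p i * chernoffTail p lam (i + 1) m + (1 - p i) * chernoffTail p lam (i + 1) (m + 1) := by
  rw [chernoffTail, filter_le_val_eq_insert, Finset.prod_insert (by simp), chernoffTail,
    chernoffTail]
  have h : Real.exp (-(lam * m)) = Real.exp (-(lam * (m + 1 : ℕ))) * Real.exp lam := by
    rw [← Real.exp_add]
    congr 1
    push_cast
    ring
  rw [h]
  ring

theorem chernoffTail_nonneg {n : ℕ} {p : Fin n → ℝ} (hp : ∀ i, 0 ≤ p i) {lam : ℝ} (hl : 0 ≤ lam)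
    (i m : ℕ) : 0 ≤ chernoffTail p lam i m := by
  have h1 : 0 ≤ Real.exp lam - 1 := by linarith [Real.add_one_le_exp lam]
  exact mul_nonneg (Real.exp_nonneg _)
    (Finset.prod_nonneg fun j _ => by linarith [mul_nonneg (hp j) h1])

theorem one_le_chernoffTail_zero {n : ℕ} {p : Fin n → ℝ} (hp : ∀ i, 0 ≤ p i) {lam : ℝ}
    (hl : 0 ≤ lam) (i : ℕ) : 1 ≤ chernoffTail p lam i 0 := by
  have h1 : 0 ≤ Real.exp lam - 1 := by linarith [Real.add_one_le_exp lam]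
  simp only [chernoffTail, Nat.cast_zero, mul_zero, neg_zero, Real.exp_zero, one_mul]
  calc (1 : ℝ) = ∏ j : Fin n with i ≤ j.val, 1 := Finset.prod_const_one.symm
    _ ≤ _ := Finset.prod_le_prod (fun _ _ => zero_le_one) fun j _ => by
        linarith [mul_nonneg (hp j) h1]

theorem chernoffTail_le {n : ℕ} {p : Fin n → ℝ} (hp : ∀ i, 0 ≤ p i) {lam : ℝ} (hl : 0 ≤ lam)
    (m : ℕ) : chernoffTail p lam 0 m ≤ Real.exp (-(lam * m) + (∑ i, p i) * (Real.exp lam - 1)) := by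
  have h1 : 0 ≤ Real.exp lam - 1 := by linarith [Real.add_one_le_exp lam]
  rw [Real.exp_add, Finset.sum_mul, Real.exp_sum, chernoffTail]
  refine mul_le_mul_of_nonneg_left ?_ (Real.exp_nonneg _)
  simp only [Nat.zero_le, Finset.filter_true]
  refine Finset.prod_le_prod (fun j _ => by linarith [mul_nonneg (hp j) h1]) fun j _ => ?_
  linarith [Real.add_one_le_exp (p j * (Real.exp lam - 1))]

/-- The potential of the policy that independently tries to accept the `i`-th value `z` with
probability `a z`, as long as there are slots left. -/
noncomputable def thresholdPotential {n : ℕ} (D : Fin n → Measure ℝ) (a : ℝ → ENNReal) (lam : ℝ)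
    (i m : ℕ) : ENNReal :=
  (∑ j : Fin n with i ≤ j.val, ∫⁻ z, a z * ENNReal.ofReal z ∂(D j)) *
    (1 - ENNReal.ofReal (chernoffTail (fun j => (∫⁻ z, a z ∂(D j)).toReal) lam i m))

/-- The maximum dominates accepting with probability `a z`. The value collected now is counted in
full, and the tail recursion handles the rest. -/
theorem isSubPotential_thresholdPotential {n : ℕ} (D : Fin n → Measure ℝ)
    [∀ i, IsProbabilityMeasure (D i)] {a : ℝ → ENNReal} (ha : Measurable a) (ha1 : ∀ z, a z ≤ 1)
    {lam : ℝ} (hl : 0 ≤ lam) : IsSubPotential D (thresholdPotential D a lam) where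
  last m := by
    have : (Finset.univ.filter fun j : Fin n => n ≤ j.val) = ∅ :=
      Finset.filter_eq_empty_iff.2 fun j _ => by omega
    simp [thresholdPotential, this]
  no_slots i := by
    rw [thresholdPotential, tsub_eq_zero_of_le, mul_zero]
    exact ENNReal.one_le_ofReal.2
      (one_le_chernoffTail_zero (fun j => ENNReal.toReal_nonneg) hl i)
  step i m := by
    have hp0 : ∀ j, 0 ≤ (∫⁻ z, a z ∂(D j)).toReal := fun j => ENNReal.toReal_nonneg
    have hple : ∫⁻ z, a z ∂(D i) ≤ 1 := by
      calc ∫⁻ z, a z ∂(D i) ≤ ∫⁻ _, 1 ∂(D i) := lintegral_mono ha1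
        _ = 1 := by simp
    have hpt : ∫⁻ z, a z ∂(D i) ≠ ⊤ := ne_top_of_le_ne_top ENNReal.one_ne_top hple
    have hpq : ∫⁻ z, a z ∂(D i) + ∫⁻ z, (1 - a z) ∂(D i) = 1 := by
      rw [← lintegral_add_left ha]
      simp [add_tsub_cancel_of_le (ha1 _)]
    set p := ∫⁻ z, a z ∂(D i) with hp
    set q := ∫⁻ z, (1 - a z) ∂(D i) with hq
    have hqp : q = ENNReal.ofReal (1 - p.toReal) := by
      rw [ENNReal.ofReal_sub _ ENNReal.toReal_nonneg, ENNReal.ofReal_toReal hpt,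
        ENNReal.ofReal_one, ← hpq, ENNReal.add_sub_cancel_left hpt]
    set A := thresholdPotential D a lam (i + 1) m with hA
    set B := thresholdPotential D a lam (i + 1) (m + 1) with hB
    have hlow : ∫⁻ z, a z * ENNReal.ofReal z ∂(D i) + (p * A + q * B) ≤
        ∫⁻ z, max (ENNReal.ofReal z + A) B ∂(D i) := by
      rw [hp, hq, ← lintegral_mul_const _ ha, ← lintegral_mul_const _ (by fun_prop),
        ← lintegral_add_left (by fun_prop), ← lintegral_add_left (by fun_prop)]
      refine lintegral_mono fun z => ?_
      calc a z * ENNReal.ofReal z + (a z * A + (1 - a z) * B)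
          = a z * (ENNReal.ofReal z + A) + (1 - a z) * B := by ring
        _ ≤ a z * max (ENNReal.ofReal z + A) B + (1 - a z) * max (ENNReal.ofReal z + A) B := by
            gcongr
            · exact le_max_left _ _
            · exact le_max_right _ _
        _ = max (ENNReal.ofReal z + A) B := by
            rw [← add_mul, add_tsub_cancel_of_le (ha1 z), one_mul]
    refine le_trans ?_ hlow
    set pr : Fin n → ℝ := fun j => (∫⁻ z, a z ∂(D j)).toReal with hpr
    have hG : ENNReal.ofReal (chernoffTail pr lam i (m + 1)) =
        p * ENNReal.ofReal (chernoffTail pr lam (i + 1) m) +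
          q * ENNReal.ofReal (chernoffTail pr lam (i + 1) (m + 1)) := by
      have h1p : 0 ≤ 1 - p.toReal := by
        have := ENNReal.toReal_mono ENNReal.one_ne_top hple
        simp only [ENNReal.toReal_one] at this
        linarith
      rw [chernoffTail_succ, ENNReal.ofReal_add, ENNReal.ofReal_mul (hp0 i),
        ENNReal.ofReal_mul h1p, hqp, ENNReal.ofReal_toReal hpt]
      · exact mul_nonneg (hp0 i) (chernoffTail_nonneg hp0 hl _ _)
      · exact mul_nonneg h1p (chernoffTail_nonneg hp0 hl _ _)
    -- Tails may exceed `1`, and truncated subtraction from `1` is convex, so averaging gives an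
    -- inequality in the needed direction.
    have hconv : 1 - ENNReal.ofReal (chernoffTail pr lam i (m + 1)) ≤
        p * (1 - ENNReal.ofReal (chernoffTail pr lam (i + 1) m)) +
          q * (1 - ENNReal.ofReal (chernoffTail pr lam (i + 1) (m + 1))) := by
      rw [hG, tsub_le_iff_right]
      calc (1 : ENNReal) = p * 1 + q * 1 := by rw [mul_one, mul_one, hpq]
        _ ≤ p * (1 - ENNReal.ofReal (chernoffTail pr lam (i + 1) m) +
              ENNReal.ofReal (chernoffTail pr lam (i + 1) m)) +
            q * (1 - ENNReal.ofReal (chernoffTail pr lam (i + 1) (m + 1)) +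
              ENNReal.ofReal (chernoffTail pr lam (i + 1) (m + 1))) := by
            gcongr <;> exact le_tsub_add
        _ = _ := by ring
    rw [thresholdPotential, filter_le_val_eq_insert, Finset.sum_insert (by simp), add_mul]
    refine add_le_add (mul_le_of_le_one_right zero_le tsub_le_self) ?_
    refine (mul_le_mul_right hconv _).trans_eq ?_
    rw [hA, hB, thresholdPotential, thresholdPotential]
    ring

/-! ### Choice of parameters and conclusion -/

theorem inv_le_mul_one_sub_exp {t R x : ℝ} (ht : 0 < t) (ht1 : t ≤ 1) (hR : R * t ^ 4 = 1)
    (hx : x ≤ (1 - t / 2) * R) :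
    (1 + 33 * t)⁻¹ ≤
      (1 - t / 2) * (1 - Real.exp (-(t / 4 * R) + x * (Real.exp (t / 4) - 1))) := by
  have hRpos : 0 < R := by
    by_contra! h
    nlinarith [mul_nonneg (neg_nonneg.2 h) (pow_pos ht 4).le]
  have hRt : R * t ^ 2 = 1 / t ^ 2 := by
    field_simp
    linarith
  have he := Real.abs_exp_sub_one_sub_id_le (x := t / 4) (by rw [abs_of_pos] <;> linarith)
  have he2 : Real.exp (t / 4) - 1 ≤ t / 4 + (t / 4) ^ 2 := by linarith [(abs_le.1 he).2]
  have he0 : 0 ≤ Real.exp (t / 4) - 1 := by linarith [Real.add_one_le_exp (t / 4)]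
  -- The linear gain is R t²/8 and the quadratic error of `exp` costs at most R t²/16; the rest is
  -- 1/(16 t²) because R t⁴ = 1.
  have hexp : -(t / 4 * R) + x * (Real.exp (t / 4) - 1) ≤ -(1 / (16 * t ^ 2)) := by
    have h1 : x * (Real.exp (t / 4) - 1) ≤ (1 - t / 2) * R * (t / 4 + (t / 4) ^ 2) :=
      (mul_le_mul_of_nonneg_right hx he0).trans
        (mul_le_mul_of_nonneg_left he2 (mul_nonneg (by linarith) hRpos.le))
    have h2 : 1 / (16 * t ^ 2) = R * t ^ 2 / 16 := by rw [hRt]; field_simp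
    have h3 : 0 ≤ R * t ^ 3 := by positivity
    rw [h2]
    nlinarith
  have hg : Real.exp (-(t / 4 * R) + x * (Real.exp (t / 4) - 1)) ≤ (1 + 1 / (16 * t ^ 2))⁻¹ := by
    refine (Real.exp_le_exp.2 hexp).trans ?_
    rw [Real.exp_neg]
    refine inv_anti₀ (by positivity) ?_
    linarith [Real.add_one_le_exp (1 / (16 * t ^ 2))]
  have hval : 1 - (1 + 1 / (16 * t ^ 2))⁻¹ = (1 + 16 * t ^ 2)⁻¹ := by
    field_simp
    ring
  -- After clearing denominators this is 32.5 t² ≤ 32.5 t, with equality at `t = 1`.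
  calc (1 + 33 * t)⁻¹ ≤ (1 - t / 2) * (1 + 16 * t ^ 2)⁻¹ := by
        rw [← div_eq_mul_inv, inv_eq_one_div, div_le_div_iff₀ (by positivity) (by positivity)]
        nlinarith
    _ ≤ _ := by
        rw [← hval]
        exact mul_le_mul_of_nonneg_left (by linarith) (by linarith)

theorem exists_algorithm_ratio {r : ℕ} {t : ℝ} (ht : 0 < t) (ht1 : t ≤ 1)
    (hrt : (r : ℝ) * t ^ 4 = 1) {n : ℕ} (D : Fin n → Measure ℝ)
    [∀ i, IsProbabilityMeasure (D i)] (hD : ∀ i, ∀ᵐ z ∂(D i), 0 ≤ z) :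
    ∃ A : OnlineAlgorithm n r,
      OnlineAlgorithm.HasApproximationRatio.{u} A D (1 + 33 * t) := by
  have hr0 : 0 < r := by
    refine Nat.pos_of_ne_zero fun h => ?_
    simp [h] at hrt
  obtain ⟨T, b, hT, hb, hb1, hblt, hbgt, hbr, hrT⟩ := exists_threshold (∑ i, D i) hr0
  rw [lintegral_finsetSum_measure] at hbr hrT
  have hc0 : 0 ≤ 1 - t / 2 := by linarith
  -- Thinning keeps the expected number of acceptances at least r t/2 below `r`, the slack the
  -- Chernoff bound needs.
  set c := ENNReal.ofReal (1 - t / 2) with hc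
  have hc1 : c ≤ 1 := ENNReal.ofReal_le_one.2 (by linarith)
  have ha : Measurable fun z => c * b z := hb.const_mul c
  have ha1 : ∀ z, c * b z ≤ 1 := fun z => mul_le_one' hc1 (hb1 z)
  set p : Fin n → ℝ := fun j => (∫⁻ z, c * b z ∂(D j)).toReal with hp
  have hsum : ∑ j, p j ≤ (1 - t / 2) * r := by
    have hfin : ∀ j, ∫⁻ z, b z ∂(D j) ≠ ⊤ := fun j =>
      ne_top_of_le_ne_top (ENNReal.natCast_ne_top r)
        ((Finset.single_le_sum (fun _ _ => zero_le) (Finset.mem_univ j)).trans hbr)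
    have h1 : ∀ j, p j = (1 - t / 2) * (∫⁻ z, b z ∂(D j)).toReal := fun j => by
      rw [hp]
      simp only
      rw [lintegral_const_mul _ hb, ENNReal.toReal_mul, hc, ENNReal.toReal_ofReal hc0]
    rw [Finset.sum_congr rfl fun j _ => h1 j, ← Finset.mul_sum,
      ← ENNReal.toReal_sum fun j _ => hfin j]
    refine mul_le_mul_of_nonneg_left ?_ hc0
    simpa using ENNReal.toReal_mono (ENNReal.natCast_ne_top r) hbr
  refine ⟨greedyAlgorithm n r (thresholdPotential D (fun z => c * b z) (t / 4)), ?_⟩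
  intro Ω _ P _ Z W h
  have hl : 0 ≤ t / 4 := by linarith
  refine le_trans ?_ (potential_le_expectedReward
    (isSubPotential_thresholdPotential D ha ha1 hl) hD h r)
  have hopt := lintegral_topSum_le h.measurable_Z h.law_Z hT hb hblt hbgt hrT
  have htail := chernoffTail_le (p := p) (fun j => ENNReal.toReal_nonneg) hl r
  have hfactor : (ENNReal.ofReal (1 + 33 * t))⁻¹ ≤
      c * (1 - ENNReal.ofReal (chernoffTail p (t / 4) 0 r)) := by
    rw [← ENNReal.ofReal_inv_of_pos (by positivity), ← ENNReal.ofReal_one,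
      ← ENNReal.ofReal_sub _ (chernoffTail_nonneg (fun j => ENNReal.toReal_nonneg) hl 0 r), hc,
      ← ENNReal.ofReal_mul hc0]
    refine ENNReal.ofReal_le_ofReal ?_
    exact (inv_le_mul_one_sub_exp ht ht1 hrt hsum).trans
      (mul_le_mul_of_nonneg_left (by linarith) hc0)
  rw [div_eq_mul_inv]
  refine (mul_le_mul' hopt hfactor).trans_eq ?_
  simp only [thresholdPotential, Nat.zero_le, Finset.filter_true, mul_assoc]
  have hval : ∀ j, ∫⁻ z, c * (b z * ENNReal.ofReal z) ∂(D j) =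
      c * ∫⁻ z, b z * ENNReal.ofReal z ∂(D j) := fun j =>
    lintegral_const_mul c (hb.mul ENNReal.measurable_ofReal)
  rw [Finset.sum_congr rfl fun j _ => hval j, ← Finset.mul_sum]
  ring

theorem mainTheorem3 :
    ∃ C : ℝ, 0 < C ∧ ∀ r : ℕ, 2 ≤ r →
      ∀ (n : ℕ) (D : Fin n → Measure ℝ),
        (∀ i, IsProbabilityMeasure (D i)) → (∀ i, ∀ᵐ z ∂(D i), 0 ≤ z) →
          ∃ A : OnlineAlgorithm n r,
            OnlineAlgorithm.HasApproximationRatio.{u} A D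
              (1 + C * (Real.log r ^ (3 / 2 : ℝ) / (r : ℝ) ^ (1 / 4 : ℝ))) := by
  have hlog2 : 0 < Real.log 2 := Real.log_pos (by norm_num)
  have hK : 0 < Real.log 2 ^ (3 / 2 : ℝ) := Real.rpow_pos_of_pos hlog2 _
  -- Since `r ≥ 2`, dividing by (log 2)^(3/2) makes the logarithmic factor at least `1`.
  refine ⟨33 / Real.log 2 ^ (3 / 2 : ℝ), by positivity, fun r hr n D hprob hD => ?_⟩
  have hr2 : (2 : ℝ) ≤ r := by exact_mod_cast hr
  have hrpos : (0 : ℝ) < r := by linarith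
  have hroot : 0 < (r : ℝ) ^ (1 / 4 : ℝ) := Real.rpow_pos_of_pos hrpos _
  have hroot1 : 1 ≤ (r : ℝ) ^ (1 / 4 : ℝ) := Real.one_le_rpow (by linarith) (by norm_num)
  have hpow : ((r : ℝ) ^ (1 / 4 : ℝ)) ^ 4 = r := by
    rw [← Real.rpow_natCast, ← Real.rpow_mul hrpos.le]
    norm_num
  obtain ⟨A, hA⟩ := exists_algorithm_ratio.{u} (r := r) (t := ((r : ℝ) ^ (1 / 4 : ℝ))⁻¹)
    (inv_pos.2 hroot) (inv_le_one_of_one_le₀ hroot1)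
    (by rw [inv_pow, hpow, mul_inv_cancel₀ hrpos.ne']) D hD
  refine ⟨A, fun Ω _ P _ Z W h => le_trans ?_ (hA Ω P Z W h)⟩
  refine ENNReal.div_le_div_left (ENNReal.ofReal_le_ofReal ?_) _
  have hlog : Real.log 2 ^ (3 / 2 : ℝ) ≤ Real.log r ^ (3 / 2 : ℝ) :=
    Real.rpow_le_rpow hlog2.le (Real.log_le_log (by norm_num) hr2) (by norm_num)
  have hratio : 1 ≤ Real.log r ^ (3 / 2 : ℝ) / Real.log 2 ^ (3 / 2 : ℝ) := (one_le_div hK).2 hlog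
  calc 1 + 33 * ((r : ℝ) ^ (1 / 4 : ℝ))⁻¹
      ≤ 1 + 33 * ((r : ℝ) ^ (1 / 4 : ℝ))⁻¹ *
          (Real.log r ^ (3 / 2 : ℝ) / Real.log 2 ^ (3 / 2 : ℝ)) := by
        have := le_mul_of_one_le_right
          (show 0 ≤ 33 * ((r : ℝ) ^ (1 / 4 : ℝ))⁻¹ by positivity) hratio
        linarith
    _ = _ := by
        rw [div_eq_mul_inv, div_eq_mul_inv, div_eq_mul_inv]
        ring
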